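/- Let $\mathcal{H}$ and $\mathcal{K}$ be Hilbert spaces over the same field $\mathbb{R}$ or $\mathbb{C}$, and let $\mathcal{B}(\mathcal{H},\mathcal{K})$ be the set of bounded linear operators from $\mathcal{H}$ to $\mathcal{K}$. For $A,C\in\mathcal{B}(\mathcal{H},\mathcal{K})$ write $A\overset{*}{\leq}C$ (the star partial order) if $AA^*=CA^*$ and $A^*A=A^*C$. A star-supremum of $A,B\in\mathcal{B}(\mathcal{H},\mathcal{K})$ is a least upper bound of $A$ and $B$ for this order, that is, an operator $S\in\mathcal{B}(\mathcal{H},\mathcal{K})$ with $A\overset{*}{\leq}S$ and $B\overset{*}{\leq}S$, such that $S\overset{*}{\leq}D$ for every $D\in\mathcal{B}(\mathcal{H},\mathcal{K})$ with $A\overset{*}{\leq}D$ and $B\overset{*}{\leq}D$. Let $A,B\in\mathcal{B}(\mathcal{H},\mathcal{K})$ be such that the range $\mathcal{R}(A-B)$ is closed in $\mathcal{K}$. Then the star-supremum of $A$ and $B$ exists if and only if $$AA^*B=AB^*B\quad\text{and}\quad BA^*A=BB^*A.$$ -/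

import Mathlib

open scoped InnerProduct

/-- Drazin's star partial order on bounded operators between Hilbert spaces:
`A` is below `C` when `A A* = C A*` and `A* A = A* C`. -/
def StarLE {𝕜 H K : Type*} [RCLike 𝕜]
    [NormedAddCommGroup H] [InnerProductSpace 𝕜 H] [CompleteSpace H]
    [NormedAddCommGroup K] [InnerProductSpace 𝕜 K] [CompleteSpace K]
    (A C : H →L[𝕜] K) : Prop :=
  A ∘L A† = C ∘L A† ∧ A† ∘L A = A† ∘L C

/-- `S` is the star-supremum of `A` and `B`: the least upper bound of `A` and `B`
for the star partial order. -/
def IsStarSup {𝕜 H K : Type*} [RCLike 𝕜]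
    [NormedAddCommGroup H] [InnerProductSpace 𝕜 H] [CompleteSpace H]
    [NormedAddCommGroup K] [InnerProductSpace 𝕜 K] [CompleteSpace K]
    (A B S : H →L[𝕜] K) : Prop :=
  StarLE A S ∧ StarLE B S ∧
    ∀ D : H →L[𝕜] K, StarLE A D → StarLE B D → StarLE S D

section

variable {𝕜 H K : Type*} [RCLike 𝕜]
    [NormedAddCommGroup H] [InnerProductSpace 𝕜 H] [CompleteSpace H]
    [NormedAddCommGroup K] [InnerProductSpace 𝕜 K] [CompleteSpace K]

/-! Any common upper bound `D` forces the identities, since `A A* B = A D* B = A B* B`. Conversely,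
cutting a common upper bound down to the orthogonal complement of `ker A ⊓ ker B` gives the supremum
(`exists_isStarSup_of_starLE`), so only a bound is needed. With `T = A - B`, the identities say `B*
T A* = 0 = A* T B*`; closed range gives a bounded generalized inverse of `T`, from which
`exists_starLE_starLE` builds the bound. -/

/-- A bounded operator with closed range has a bounded generalized inverse: an operator `R` with
`T R T = T` and `R T` self-adjoint. -/
theorem exists_generalized_inverse (T : H →L[𝕜] K) (hT : IsClosed (Set.range T)) :
    ∃ R : K →L[𝕜] H, T ∘L R ∘L T = T ∧ (R ∘L T)† = R ∘L T := by
  have hclosed : IsClosed (T.ker : Set H) := T.isClosed_ker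
  have : CompleteSpace T.ker := hclosed.completeSpace_coe
  set P := T.kerᗮ.starProjection with hP
  have hTP : ∀ x, T (P x) = T x := by
    intro x
    have h : x - P x ∈ T.kerᗮᗮ := Submodule.sub_starProjection_mem_orthogonal x
    rw [Submodule.orthogonal_orthogonal, LinearMap.mem_ker] at h
    have h' : T (x - P x) = 0 := h
    rw [map_sub, sub_eq_zero] at h'
    exact h'.symm
  set f : T.kerᗮ →L[𝕜] K := T ∘L T.kerᗮ.subtypeL with hf
  have hinj : Function.Injective f := by
    rw [injective_iff_map_eq_zero]
    intro x hx
    have h1 : (x : H) ∈ T.ker := hx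
    exact Subtype.ext (inner_self_eq_zero (𝕜 := 𝕜).mp
      (Submodule.inner_right_of_mem_orthogonal h1 x.2))
  have hrange : Set.range f = Set.range T := by
    apply Set.Subset.antisymm
    · rintro _ ⟨x, rfl⟩
      exact ⟨x, rfl⟩
    · rintro _ ⟨x, rfl⟩
      exact ⟨⟨P x, Submodule.starProjection_apply_mem _ x⟩, hTP x⟩
  have hfc : IsClosed (Set.range f) := by rwa [hrange]
  have : CompleteSpace f.range := hfc.completeSpace_coe
  set e := f.equivRange hinj hfc
  -- Project onto the range, then invert `T` restricted to `(ker T)ᗮ`.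
  set R : K →L[𝕜] H :=
    T.kerᗮ.subtypeL ∘L (e.symm : f.range →L[𝕜] T.kerᗮ) ∘L f.range.orthogonalProjectionOnto with hR
  have hRT : R ∘L T = P := by
    ext x
    have hx : T x = f (T.kerᗮ.orthogonalProjectionOnto x) := (hTP x).symm
    have hx' : f.range.orthogonalProjectionOnto (T x) = e (T.kerᗮ.orthogonalProjectionOnto x) := by
      rw [hx]
      exact Submodule.orthogonalProjectionOnto_mem_subspace_eq_self
        (e (T.kerᗮ.orthogonalProjectionOnto x))
    change ((e.symm (f.range.orthogonalProjectionOnto (T x)) : T.kerᗮ) : H) = _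
    rw [hx', e.symm_apply_apply]
    rfl
  refine ⟨R, ?_, ?_⟩
  · rw [hRT]
    exact ContinuousLinearMap.ext hTP
  · rw [hRT]
    exact isSelfAdjoint_starProjection _

theorem ContinuousLinearMap.eq_zero_of_adjoint_apply_apply_eq_zero {T : H →L[𝕜] K} {x : H}
    (h : (T†) (T x) = 0) : T x = 0 := by
  have h' : x ∈ (T† ∘L T).ker := h
  rw [ContinuousLinearMap.ker_adjoint_comp_self] at h'
  exact h'

/-- An operator vanishing on the ranges of `A†` and `B†` only sees the component in
`ker A ⊓ ker B`. -/
theorem comp_starProjection_ker_inf_ker {L : Type*} [NormedAddCommGroup L]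
    [InnerProductSpace 𝕜 L] [CompleteSpace L] {A B : H →L[𝕜] K} {W : H →L[𝕜] L}
    [(A.ker ⊓ B.ker).HasOrthogonalProjection]
    (hA : W ∘L A† = 0) (hB : W ∘L B† = 0) :
    W ∘L (A.ker ⊓ B.ker).starProjection = W := by
  have hA' : A ∘L W† = 0 := by
    simpa [ContinuousLinearMap.adjoint_comp] using congrArg ContinuousLinearMap.adjoint hA
  have hB' : B ∘L W† = 0 := by
    simpa [ContinuousLinearMap.adjoint_comp] using congrArg ContinuousLinearMap.adjoint hB
  have h : (A.ker ⊓ B.ker).starProjection ∘L W† = W† := by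
    ext x
    exact Submodule.starProjection_eq_self_iff.mpr
      ⟨DFunLike.congr_fun hA' x, DFunLike.congr_fun hB' x⟩
  have hs : ((A.ker ⊓ B.ker).starProjection)† = (A.ker ⊓ B.ker).starProjection :=
    isSelfAdjoint_starProjection _
  simpa [ContinuousLinearMap.adjoint_comp, hs] using congrArg ContinuousLinearMap.adjoint h

/-- Two operators with a common upper bound for the star order have a star-supremum. -/
theorem exists_isStarSup_of_starLE {A B D : H →L[𝕜] K} (hA : StarLE A D) (hB : StarLE B D) :
    ∃ S : H →L[𝕜] K, IsStarSup A B S := by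
  have hclosed : IsClosed ((A.ker ⊓ B.ker : Submodule 𝕜 H) : Set H) :=
    A.isClosed_ker.inter B.isClosed_ker
  have : CompleteSpace (A.ker ⊓ B.ker : Submodule 𝕜 H) := hclosed.completeSpace_coe
  have hW := fun W : H →L[𝕜] K => comp_starProjection_ker_inf_ker (A := A) (B := B) (W := W)
  have hW' := fun W : H →L[𝕜] H => comp_starProjection_ker_inf_ker (A := A) (B := B) (W := W)
  set P := (A.ker ⊓ B.ker).starProjection with hP
  have hPs : P† = P := isSelfAdjoint_starProjection _
  have hPP : P ∘L P = P := (A.ker ⊓ B.ker).isIdempotentElem_starProjection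
  have hmem : ∀ x, P x ∈ A.ker ⊓ B.ker := fun x => Submodule.starProjection_apply_mem _ x
  have hAP : A ∘L P = 0 := ContinuousLinearMap.ext fun x => (hmem x).1
  have hBP : B ∘L P = 0 := ContinuousLinearMap.ext fun x => (hmem x).2
  have hPA : P ∘L A† = 0 := by
    simpa [ContinuousLinearMap.adjoint_comp, hPs] using congrArg ContinuousLinearMap.adjoint hAP
  have hPB : P ∘L B† = 0 := by
    simpa [ContinuousLinearMap.adjoint_comp, hPs] using congrArg ContinuousLinearMap.adjoint hBP
  set S : H →L[𝕜] K := D - D ∘L P with hS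
  have hSP : S ∘L P = 0 := by
    rw [hS, ContinuousLinearMap.sub_comp, ContinuousLinearMap.comp_assoc, hPP, sub_self]
  have hPS : P ∘L S† = 0 := by
    simpa [ContinuousLinearMap.adjoint_comp, hPs] using congrArg ContinuousLinearMap.adjoint hSP
  have key : ∀ C : H →L[𝕜] K, StarLE C D → C ∘L P = 0 → P ∘L C† = 0 → StarLE C S := by
    intro C hC h1 h2
    constructor
    · rw [hS, ContinuousLinearMap.sub_comp, ContinuousLinearMap.comp_assoc, h2,
        ContinuousLinearMap.comp_zero, sub_zero, hC.1]
    · rw [hS, ContinuousLinearMap.comp_sub, ← ContinuousLinearMap.comp_assoc, ← hC.2,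
        ContinuousLinearMap.comp_assoc, h1, ContinuousLinearMap.comp_zero, sub_zero]
  have hAS := key A hA hAP hPA
  have hBS := key B hB hBP hPB
  refine ⟨S, hAS, hBS, fun C hAC hBC => ?_⟩
  have hY : (S - C) ∘L P = S - C := hW (S - C)
    (by rw [ContinuousLinearMap.sub_comp, ← hAS.1, ← hAC.1, sub_self])
    (by rw [ContinuousLinearMap.sub_comp, ← hBS.1, ← hBC.1, sub_self])
  have hYA : (S - C)† ∘L A = 0 := by
    have h : A† ∘L (S - C) = 0 := by
      rw [ContinuousLinearMap.comp_sub, ← hAS.2, ← hAC.2, sub_self]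
    simpa [ContinuousLinearMap.adjoint_comp] using congrArg ContinuousLinearMap.adjoint h
  have hYB : (S - C)† ∘L B = 0 := by
    have h : B† ∘L (S - C) = 0 := by
      rw [ContinuousLinearMap.comp_sub, ← hBS.2, ← hBC.2, sub_self]
    simpa [ContinuousLinearMap.adjoint_comp] using congrArg ContinuousLinearMap.adjoint h
  -- On the range of `A†`, `S` agrees with `A`, and `(S - C)†` kills `A`; likewise for `B`. On `ker
  -- A ⊓ ker B`, `S` itself vanishes.
  have hYS : (S - C)† ∘L S = 0 := by
    rw [← hW' ((S - C)† ∘L S)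
      (by rw [ContinuousLinearMap.comp_assoc, ← hAS.1, ← ContinuousLinearMap.comp_assoc, hYA,
            ContinuousLinearMap.zero_comp])
      (by rw [ContinuousLinearMap.comp_assoc, ← hBS.1, ← ContinuousLinearMap.comp_assoc, hYB,
            ContinuousLinearMap.zero_comp]),
      ContinuousLinearMap.comp_assoc, hSP, ContinuousLinearMap.comp_zero]
  have hSY : S† ∘L (S - C) = 0 := by
    simpa [ContinuousLinearMap.adjoint_comp] using congrArg ContinuousLinearMap.adjoint hYS
  constructor
  · rw [← sub_eq_zero, ← ContinuousLinearMap.sub_comp, ← hY, ContinuousLinearMap.comp_assoc, hPS,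
      ContinuousLinearMap.comp_zero]
  · rw [← sub_eq_zero, ← ContinuousLinearMap.comp_sub, hSY]

/-- Both sides equal `A D* B`. -/
theorem StarLE.comp_adjoint_comp_eq {A B D : H →L[𝕜] K} (hA : StarLE A D) (hB : StarLE B D) :
    A ∘L A† ∘L B = A ∘L B† ∘L B := by
  have hA' : A ∘L A† = A ∘L D† := by
    simpa [ContinuousLinearMap.adjoint_comp] using congrArg ContinuousLinearMap.adjoint hA.1
  have hB' : B† ∘L B = D† ∘L B := by
    simpa [ContinuousLinearMap.adjoint_comp] using congrArg ContinuousLinearMap.adjoint hB.2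
  rw [← ContinuousLinearMap.comp_assoc, hA', hB', ContinuousLinearMap.comp_assoc]

/-- If `A` and `B` are star-compatible and `A - B` has closed range, then `A` and `B` have a common
upper bound for the star order. -/
theorem exists_starLE_starLE {A B : H →L[𝕜] K} (hAB : IsClosed (Set.range (A - B)))
    (h1 : A ∘L A† ∘L B = A ∘L B† ∘L B) (h2 : B ∘L A† ∘L A = B ∘L B† ∘L A) :
    ∃ D : H →L[𝕜] K, StarLE A D ∧ StarLE B D := by
  obtain ⟨R, hTRT, hRT⟩ := exists_generalized_inverse (A - B) hAB
  set T := A - B with hT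
  have hB : B = A - T := by rw [hT, sub_sub_cancel]
  have hBTA : B† ∘L T ∘L A† = 0 := by
    have h : A ∘L T† ∘L B = 0 := by
      rw [hT, map_sub, ContinuousLinearMap.sub_comp, ContinuousLinearMap.comp_sub, h1, sub_self]
    simpa [ContinuousLinearMap.adjoint_comp, ContinuousLinearMap.comp_assoc]
      using congrArg ContinuousLinearMap.adjoint h
  have hATB : A† ∘L T ∘L B† = 0 := by
    have h : B ∘L T† ∘L A = 0 := by
      rw [hT, map_sub, ContinuousLinearMap.sub_comp, ContinuousLinearMap.comp_sub, h2, sub_self]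
    simpa [ContinuousLinearMap.adjoint_comp, ContinuousLinearMap.comp_assoc]
      using congrArg ContinuousLinearMap.adjoint h
  have hTdag : T† = A† - B† := map_sub _ _ _
  -- Both sides equal `-B* T B*`. This is the compatibility condition for solving `X T* = T B*` and
  -- `T* X = B* T` simultaneously.
  have hinter : T† ∘L T ∘L B† = B† ∘L T ∘L T† := by
    calc T† ∘L T ∘L B† = A† ∘L T ∘L B† - B† ∘L T ∘L B† := by
          rw [hTdag, ContinuousLinearMap.sub_comp]
      _ = B† ∘L T ∘L A† - B† ∘L T ∘L B† := by rw [hATB, hBTA]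
      _ = B† ∘L T ∘L T† := by
          rw [hTdag, ContinuousLinearMap.comp_sub, ContinuousLinearMap.comp_sub]
  have hinter_apply : ∀ y, (T†) (T ((B†) y)) = (B†) (T ((T†) y)) := DFunLike.congr_fun hinter
  have hRT' : T† ∘L R† = R ∘L T := by rw [← ContinuousLinearMap.adjoint_comp, hRT]
  have hRT_apply : ∀ x, (T†) ((R†) x) = R (T x) := DFunLike.congr_fun hRT'
  have hTRT_apply : ∀ x, T (R (T x)) = T x := DFunLike.congr_fun hTRT
  have hTRTdag : T† ∘L R† ∘L T† = T† := by
    simpa [ContinuousLinearMap.adjoint_comp, ContinuousLinearMap.comp_assoc]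
      using congrArg ContinuousLinearMap.adjoint hTRT
  have hTRTdag_apply : ∀ y, (T†) ((R†) ((T†) y)) = (T†) y := DFunLike.congr_fun hTRTdag
  have hBTA_apply : ∀ y, (B†) (T ((A†) y)) = 0 := DFunLike.congr_fun hBTA
  have hATB_apply : ∀ y, (A†) (T ((B†) y)) = 0 := DFunLike.congr_fun hATB
  have hXA : ∀ y, T ((B†) ((R†) ((A†) y))) = 0 := fun y =>
    ContinuousLinearMap.eq_zero_of_adjoint_apply_apply_eq_zero
      (by rw [hinter_apply, hRT_apply, hTRT_apply, hBTA_apply])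
  have hXT : ∀ y, T ((B†) ((R†) ((T†) y))) = T ((B†) y) := fun y => by
    rw [← sub_eq_zero, ← map_sub, ← map_sub]
    exact ContinuousLinearMap.eq_zero_of_adjoint_apply_apply_eq_zero
      (by rw [hinter_apply, map_sub, hTRTdag_apply, sub_self, map_zero, map_zero])
  have hTX : ∀ x, (T†) (T ((B†) ((R†) x))) = (B†) (T x) := fun x => by
    rw [hinter_apply, hRT_apply, hTRT_apply]
  have hTdag_apply : ∀ y, (T†) y = (A†) y - (B†) y := fun y => by rw [hTdag]; rfl
  have hT_apply : ∀ x, T x = A x - B x := fun _ => rfl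
  -- `A + X` is a common bound iff `X A* = 0`, `A* X = 0`, `X B* = -T B*` and `B* X = -B* T`. Then
  -- `X T* = T B*`, which suggests `X = T B* R*`, as `R*` is a generalized inverse of `T*`.
  refine ⟨A + T ∘L B† ∘L R†, ⟨?_, ?_⟩, ?_, ?_⟩
  · ext y
    change A ((A†) y) = A ((A†) y) + T ((B†) ((R†) ((A†) y)))
    rw [hXA, add_zero]
  · ext x
    change (A†) (A x) = (A†) (A x + T ((B†) ((R†) x)))
    rw [map_add, hATB_apply, add_zero]
  · ext y
    change B ((B†) y) = A ((B†) y) + T ((B†) ((R†) ((B†) y)))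
    have h := hXT y
    rw [hTdag_apply, map_sub, map_sub, map_sub, hXA, zero_sub] at h
    rw [← neg_neg (T ((B†) ((R†) ((B†) y)))), h, hT_apply]
    abel
  · ext x
    change (B†) (B x) = (B†) (A x + T ((B†) ((R†) x)))
    have h := hTX x
    rw [hTdag_apply, hATB_apply, zero_sub] at h
    rw [map_add, ← neg_neg ((B†) (T ((B†) ((R†) x)))), h, hT_apply, map_sub]
    abel

end

theorem lemma5p9 {𝕜 H K : Type*} [RCLike 𝕜]
    [NormedAddCommGroup H] [InnerProductSpace 𝕜 H] [CompleteSpace H]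
    [NormedAddCommGroup K] [InnerProductSpace 𝕜 K] [CompleteSpace K]
    (A B : H →L[𝕜] K) (hAB : IsClosed (Set.range (A - B))) :
    (∃ S : H →L[𝕜] K, IsStarSup A B S) ↔
      (A ∘L A† ∘L B = A ∘L B† ∘L B ∧ B ∘L A† ∘L A = B ∘L B† ∘L A) := by
  constructor
  · rintro ⟨S, hA, hB, -⟩
    exact ⟨hA.comp_adjoint_comp_eq hB, (hB.comp_adjoint_comp_eq hA).symm⟩
  · rintro ⟨h1, h2⟩
    obtain ⟨D, hA, hB⟩ := exists_starLE_starLE hAB h1 h2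
    exact exists_isStarSup_of_starLE hA hB
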